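/- There is an absolute constant $C$ such that the following holds. Let $h\in\mathbb F_2^{c\times n}$, write $E=[c]$, and for $A\subseteq E$ let $h_A$ be the submatrix of the rows of $h$ indexed by $A$. Let $0<p<1$, and let $\phi$ be the probability measure on the subsets of $E$ with $$\phi(A)\propto\Big(\frac p{1-p}\Big)^{|A|}2^{\dim\ker h_A}.$$ Let $P$ be the transition matrix of the lazy single-check Metropolis dynamics for $\phi$: $P(A,B)=\frac1{2c}\min\{1,\phi(B)/\phi(A)\}$ if $|A\oplus B|=1$, $P(A,A)=1-\frac1{2c}\sum_{e\in E}\min\{1,\phi(A\oplus e)/\phi(A)\}$, and $P(A,B)=0$ otherwise. For $\Delta\in\mathbb N$ and $K\in\mathbb R$, say that a matrix $h'\in\mathbb F_2^{c\times k}$ has a primal coupling with $m$ vertices and defect at most $\Delta$ if there is a (mod 2) edge-vertex incidence matrix $g\in\mathbb F_2^{c\times m}$ of a graph on $m$ vertices with $c$ edges (parallel edges and loops allowed, a loop giving a zero row) such that $\ker g^T\supseteq\ker h'^T$ and $\dim\ker g^T-\dim\ker h'^T\le\Delta$. Call $h$ $\Delta$-graphic with constant $K$ if $h$ itself has such a coupling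 with some $m\le Kn$, and $\Delta$-cographic with constant $K$ if, for some $m\le Kn$, some matrix whose columns generate $\operatorname{col}(h)^\perp$ has such a coupling. A path is a finite sequence $\gamma=(\gamma_0,\dots,\gamma_L)$ of subsets of $E$ with $P(\gamma_i,\gamma_{i+1})>0$ for all $i<L$; its length is $L(\gamma)=L$. A flow for $\phi$ assigns to every path a weight $F(\gamma)\in[0,1]$ such that for all $I\ne J$ the weights of the paths from $I$ to $J$ sum to $\phi(I)\phi(J)$. Its congestion is $$\rho(F)=\max_{(Z,Z'):\,P(Z,Z')>0}\ \frac1{\phi(Z)P(Z,Z')}\sum_{\gamma\ni(Z,Z')}F(\gamma)L(\gamma).$$ Theorem. If $h$ is $\Delta$-graphic or $\Delta$-cographic with constant $K$, then there is a flow $F$ for $\phi$ with $$\rho(F)\le C\,K^4\,c^2\,2^{2\Delta+5}\,n^4 .$$ In particular $\rho(F)=O(c^2 2^{2\Delta+5}n^4)$ when $K$ is fixed. -/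

import Mathlib

open scoped Matrix ENNReal NNReal

noncomputable section

namespace CodeRC

/-! ### Paths, flows and congestion of a finite Markov chain -/

section Flow

variable {Ω : Type*}

/-- A finite non-empty sequence of states `(γ₀, …, γ_L)`, given by its length `L` (the number of
steps) and its entries. -/
abbrev StateSeq (Ω : Type*) : Type _ := Σ L : ℕ, (Fin (L + 1) → Ω)

/-- A path of the chain `P`: consecutive states are joined by transitions of positive
probability (staying put is allowed where `P Z Z > 0`). -/
def IsPath (P : Ω → Ω → ℝ) (γ : StateSeq Ω) : Prop :=
  ∀ i : Fin γ.1, 0 < P (γ.2 i.castSucc) (γ.2 i.succ)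

/-- `Γ(I, F)`: the paths of the chain from `I` to `F`. -/
def pathsBetween (P : Ω → Ω → ℝ) (I F : Ω) : Set (StateSeq Ω) :=
  {γ | IsPath P γ ∧ γ.2 0 = I ∧ γ.2 (Fin.last γ.1) = F}

/-- The paths of the chain that use the transition `(Z, Z')`. -/
def pathsThrough (P : Ω → Ω → ℝ) (Z Z' : Ω) : Set (StateSeq Ω) :=
  {γ | IsPath P γ ∧ ∃ i : Fin γ.1, γ.2 i.castSucc = Z ∧ γ.2 i.succ = Z'}

/-- `f` is a flow for the distribution `π` under the chain `P`: weights in `[0,1]`, with total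
weight `π(I) π(F)` on the paths from `I` to `F`, for all `I ≠ F`. -/
structure IsFlow (P : Ω → Ω → ℝ) (π : Ω → ℝ) (f : StateSeq Ω → ℝ≥0) : Prop where
  le_one : ∀ γ, f γ ≤ 1
  sum_eq : ∀ I F : Ω, I ≠ F →
    ∑' γ : pathsBetween P I F, (f γ : ℝ≥0∞) = ENNReal.ofReal (π I * π F)

/-- The congestion `ρ(f)`: the supremum, over all transitions `(Z, Z')` with `P(Z, Z') > 0`, of
`(π(Z) P(Z, Z'))⁻¹ ∑_{γ ∋ (Z, Z')} f(γ) L(γ)`, as an extended non-negative real. -/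
def congestion (P : Ω → Ω → ℝ) (π : Ω → ℝ) (f : StateSeq Ω → ℝ≥0) : ℝ≥0∞ :=
  ⨆ (Z : Ω) (Z' : Ω) (_ : 0 < P Z Z'),
    (∑' γ : pathsThrough P Z Z', (f γ : ℝ≥0∞) * ((γ : StateSeq Ω).1 : ℝ≥0∞)) /
      ENNReal.ofReal (π Z * P Z Z')

end Flow

/-! ### The random-cluster model of a parity-check matrix and its Metropolis dynamics -/

section RandomCluster

variable {c n : ℕ}

/-- `k(A) = dim ker h_A`, where `h_A` consists of the rows of `h` indexed by `A`. -/
def kerDim (h : Matrix (Fin c) (Fin n) (ZMod 2)) (A : Finset (Fin c)) : ℕ :=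
  Module.finrank (ZMod 2)
    (LinearMap.ker (h.submatrix (fun i : A => (i : Fin c)) id).mulVecLin)

/-- The weight `(p / (1 - p))^|A| 2^{k(A)}`. -/
def rcWeight (h : Matrix (Fin c) (Fin n) (ZMod 2)) (p : ℝ) (A : Finset (Fin c)) : ℝ :=
  (p / (1 - p)) ^ A.card * 2 ^ kerDim h A

/-- The random-cluster measure `φ` on the sets of checks. -/
def rcMeasure (h : Matrix (Fin c) (Fin n) (ZMod 2)) (p : ℝ) (A : Finset (Fin c)) : ℝ :=
  rcWeight h p A / ∑ B : Finset (Fin c), rcWeight h p B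

/-- Transition matrix of the lazy single-check Metropolis dynamics for a measure `φ` on the
subsets of `Fin c`. -/
def metropolis (φ : Finset (Fin c) → ℝ) (A B : Finset (Fin c)) : ℝ :=
  if (symmDiff A B).card = 1 then 1 / (2 * (c : ℝ)) * min 1 (φ B / φ A)
  else if A = B then
    1 - 1 / (2 * (c : ℝ)) * ∑ e : Fin c, min 1 (φ (symmDiff A {e}) / φ A)
  else 0

end RandomCluster

/-! ### Δ-graphic and Δ-cographic parity-check matrices -/

section Graphic

variable {c n : ℕ}

open Classical in
/-- `g` is the mod 2 edge-vertex incidence matrix of a graph with vertex set `Fin m` whose edges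
are labelled by `Fin c`. Parallel edges are allowed, and so are loops; both ends of a loop
coincide, so that its row is zero mod 2. -/
def IsEdgeVertexIncidence {m : ℕ} (g : Matrix (Fin c) (Fin m) (ZMod 2)) : Prop :=
  ∃ G : Graph (Fin m) (Fin c), G.vertexSet = Set.univ ∧ G.edgeSet = Set.univ ∧
    ∀ e v, g e v = if G.IsNonloopAt e v then 1 else 0

/-- There is a primal coupling to `h` with `m` vertices and defect at most `Δ`: an edge-vertex
incidence matrix `g` of a graph on `m` vertices with `ker gᵀ ⊇ ker hᵀ` and
`dim ker gᵀ - dim ker hᵀ ≤ Δ`. -/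
def HasPrimalCoupling (m Δ : ℕ) (h : Matrix (Fin c) (Fin n) (ZMod 2)) : Prop :=
  ∃ g : Matrix (Fin c) (Fin m) (ZMod 2), IsEdgeVertexIncidence g ∧
    LinearMap.ker hᵀ.mulVecLin ≤ LinearMap.ker gᵀ.mulVecLin ∧
    Module.finrank (ZMod 2) (LinearMap.ker gᵀ.mulVecLin) ≤
      Module.finrank (ZMod 2) (LinearMap.ker hᵀ.mulVecLin) + Δ

/-- `h'` is a column-generator matrix of `col(h)^⊥`. -/
def IsPerpGenerator {k : ℕ} (h : Matrix (Fin c) (Fin n) (ZMod 2))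
    (h' : Matrix (Fin c) (Fin k) (ZMod 2)) : Prop :=
  ∀ y : Fin c → ZMod 2, y ∈ LinearMap.range h'.mulVecLin ↔
    ∀ x ∈ LinearMap.range h.mulVecLin, x ⬝ᵥ y = 0

/-- There is a dual coupling to `h` with `m` vertices and defect at most `Δ`: a primal coupling
to a column-generator matrix of `col(h)^⊥`. -/
def HasDualCoupling (m Δ : ℕ) (h : Matrix (Fin c) (Fin n) (ZMod 2)) : Prop :=
  ∃ (k : ℕ) (h' : Matrix (Fin c) (Fin k) (ZMod 2)), IsPerpGenerator h h' ∧
    HasPrimalCoupling m Δ h'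

/-- `h` is `Δ`-graphic, where `K` is the constant in the requirement `m = O(n)` on the number of
vertices: `m ≤ K n`. -/
def IsGraphic (K : ℝ) (Δ : ℕ) (h : Matrix (Fin c) (Fin n) (ZMod 2)) : Prop :=
  ∃ m : ℕ, (m : ℝ) ≤ K * n ∧ HasPrimalCoupling m Δ h

/-- `h` is `Δ`-cographic, where `K` is the constant in the requirement `m = O(n)` on the number
of vertices: `m ≤ K n`, with `n` the number of columns of `h`. -/
def IsCographic (K : ℝ) (Δ : ℕ) (h : Matrix (Fin c) (Fin n) (ZMod 2)) : Prop :=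
  ∃ m : ℕ, (m : ℝ) ≤ K * n ∧ HasDualCoupling m Δ h

end Graphic

end CodeRC

end

open scoped Matrix ENNReal NNReal

namespace CodeRC

/-! The measure `φ` is the marginal on `A` of the weight `v ^ |A|` on pairs `(C, A)`, where `C` runs
over a binary code `𝒞` and is supported in `A` (flag `b` true) or off `A` (`b` false). In the
graphic case `𝒞 = ker hᵀ`, supports lie in `A` and `v = p / (2(1 - p))` (`rcMeasure_eq_ker`). In the
cographic case `𝒞 = col(h)`, supports avoid `A` and `v = p / (1 - p)` (`rcMeasure_eq_range`).

To route flow from `A` to `B`, attach code words `I` and `F` to them and swap `(A, I)` with `(B, F)`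
one coordinate at a time, in an order depending only on `D = I + F`. A swap preserves `D` and the
product of the joint weights, so it is a weight-preserving involution. The swapped vectors may leave
`𝒞`, but both lie in the coset of `D` restricted to the swapped set, and no coset outweighs `𝒞`
(`coset_weight_le`). Hence the mass passing through a state `M` at a given stage is at most `φ M`
times the number of cosets met (`sum_quadWeight_mix_le`).

That number is small because `D` is an even subgraph of the coupled graph: its edges can be ordered
so that every initial segment has at most two odd vertices (`exists_perm_pairBoundaries`). This
leaves at most `m² + 1` boundaries, each shared by at most `2 ^ Δ` cosets (`card_filter_liftQ_le`).
-/

open Classical in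
/-- The set that agrees with `B` on `T` and with `A` off `T`. -/
noncomputable def mix {α : Type*} [Fintype α] (T A B : Finset α) : Finset α :=
  Finset.univ.filter fun e => if e ∈ T then e ∈ B else e ∈ A

open Classical in
lemma mem_mix {α : Type*} [Fintype α] {T A B : Finset α} {e : α} :
    e ∈ mix T A B ↔ if e ∈ T then e ∈ B else e ∈ A := by
  simp [mix]

lemma mix_mix {α : Type*} [Fintype α] (T A B : Finset α) : mix T (mix T A B) (mix T B A) = A := by
  classical
  ext e
  by_cases h : e ∈ T <;> simp [mem_mix, h]

lemma card_mix_add_card_mix {α : Type*} [Fintype α] (T A B : Finset α) :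
    (mix T A B).card + (mix T B A).card = A.card + B.card := by
  classical
  have h : ∀ S : Finset α, S.card = ∑ e, if e ∈ S then 1 else 0 := by intro S; simp
  rw [h (mix T A B), h (mix T B A), h A, h B, ← Finset.sum_add_distrib, ← Finset.sum_add_distrib]
  refine Finset.sum_congr rfl fun e _ => ?_
  by_cases h : e ∈ T <;> simp [mem_mix, h, add_comm]

/-! ### Joint weights of states and code vectors, and the exchange involution -/

section Abstract

variable {c : ℕ}

open Classical in
/-- The vector that agrees with `F` on `T` and with `I` off `T`. -/
noncomputable def mixVec (T : Finset (Fin c)) (I F : Fin c → ZMod 2) : Fin c → ZMod 2 :=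
  fun e => if e ∈ T then F e else I e

open Classical in
/-- The restriction of `D` to the coordinates in `T`. -/
noncomputable def restrictTo (T : Finset (Fin c)) (D : Fin c → ZMod 2) : Fin c → ZMod 2 :=
  fun e => if e ∈ T then D e else 0

lemma mixVec_mixVec (T : Finset (Fin c)) (I F : Fin c → ZMod 2) :
    mixVec T (mixVec T I F) (mixVec T F I) = I := by
  ext e
  by_cases h : e ∈ T <;> simp [mixVec, h]

lemma mixVec_add_mixVec (T : Finset (Fin c)) (I F : Fin c → ZMod 2) :
    mixVec T I F + mixVec T F I = I + F := by
  ext e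
  by_cases h : e ∈ T <;> simp [mixVec, h, add_comm]

lemma mixVec_eq_add (T : Finset (Fin c)) (I F : Fin c → ZMod 2) :
    mixVec T I F = I + restrictTo T (I + F) := by
  ext e
  by_cases h : e ∈ T
  · simp [mixVec, restrictTo, h, ← add_assoc, CharTwo.add_self_eq_zero]
  · simp [mixVec, restrictTo, h]

/-- The support of `C` is contained in `A` (if `b` holds) or in its complement (if not). -/
def Adm (b : Prop) (C : Fin c → ZMod 2) (A : Finset (Fin c)) : Prop :=
  ∀ e, C e ≠ 0 → (e ∈ A ↔ b)

/-- Admissibility is a condition on each coordinate separately; on `T` the two conditions merely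
trade places. -/
lemma adm_mix (b : Prop) (T A B : Finset (Fin c)) (I F : Fin c → ZMod 2) :
    (Adm b (mixVec T I F) (mix T A B) ∧ Adm b (mixVec T F I) (mix T B A)) ↔
      (Adm b I A ∧ Adm b F B) := by
  simp only [Adm, ← forall_and]
  refine forall_congr' fun e => ?_
  by_cases h : e ∈ T
  · simp only [mixVec, mem_mix, h, if_true]; exact and_comm
  · simp only [mixVec, mem_mix, h, if_false]

open Classical in
/-- The joint weight of a vector `C` and a state `A`. -/
noncomputable def jointWeight (v : ℝ) (b : Prop) (C : Fin c → ZMod 2) (A : Finset (Fin c)) : ℝ :=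
  if Adm b C A then v ^ A.card else 0

lemma jointWeight_nonneg {v : ℝ} (hv : 0 < v) (b : Prop) (C : Fin c → ZMod 2)
    (A : Finset (Fin c)) : 0 ≤ jointWeight v b C A := by
  unfold jointWeight; split_ifs <;> positivity

lemma jointWeight_mix (v : ℝ) (b : Prop) (T A B : Finset (Fin c)) (I F : Fin c → ZMod 2) :
    jointWeight v b (mixVec T I F) (mix T A B) * jointWeight v b (mixVec T F I) (mix T B A) =
      jointWeight v b I A * jointWeight v b F B := by
  classical
  simp only [jointWeight, ite_zero_mul_ite_zero, adm_mix, ← pow_add, card_mix_add_card_mix]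

open Classical in
/-- The marginal weight of the state `A` when the vectors range over `𝒞`. -/
noncomputable def codeWeight (v : ℝ) (b : Prop) (𝒞 : Submodule (ZMod 2) (Fin c → ZMod 2))
    (A : Finset (Fin c)) : ℝ :=
  ∑ C, if C ∈ 𝒞 then jointWeight v b C A else 0

variable {v : ℝ} (hv : 0 < v) (b : Prop) (𝒞 : Submodule (ZMod 2) (Fin c → ZMod 2))

include hv in
lemma codeWeight_pos (A : Finset (Fin c)) : 0 < codeWeight v b 𝒞 A := by
  classical
  have h0 : jointWeight v b 0 A = v ^ A.card := if_pos (by intro e he; simp at he)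
  have : (if (0 : Fin c → ZMod 2) ∈ 𝒞 then jointWeight v b 0 A else 0) ≤ codeWeight v b 𝒞 A :=
    Finset.single_le_sum (f := fun C => if C ∈ 𝒞 then jointWeight v b C A else 0)
      (fun C _ => by split_ifs; exacts [jointWeight_nonneg hv b C A, le_rfl]) (Finset.mem_univ _)
  rw [if_pos 𝒞.zero_mem, h0] at this
  exact lt_of_lt_of_le (by positivity) this

open Classical in
include hv in
/-- A coset of `𝒞` has at most the weight of `𝒞`. -/
lemma coset_weight_le (κ : (Fin c → ZMod 2) ⧸ 𝒞) (A : Finset (Fin c)) :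
    (∑ C, if 𝒞.mkQ C = κ then jointWeight v b C A else 0) ≤ codeWeight v b 𝒞 A := by
  by_cases h : ∃ C₀, 𝒞.mkQ C₀ = κ ∧ Adm b C₀ A
  · obtain ⟨C₀, hC₀, hA⟩ := h
    -- Translation by an admissible representative `C₀` maps `𝒞` onto the coset, and admissible
    -- vectors are closed under addition. A coset without such a representative has weight zero.
    rw [codeWeight, ← Equiv.sum_comp (Equiv.addRight C₀)]
    refine Finset.sum_le_sum fun C _ => ?_
    have h1 : 𝒞.mkQ (Equiv.addRight C₀ C) = κ ↔ C ∈ 𝒞 := by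
      rw [Equiv.coe_addRight, map_add, hC₀]
      simp
    by_cases hC : C ∈ 𝒞
    · rw [if_pos (h1.2 hC), if_pos hC]
      unfold jointWeight
      by_cases ha : Adm b (Equiv.addRight C₀ C) A
      · rw [if_pos ha, if_pos]
        intro e he
        by_cases h2 : C₀ e = 0
        · exact ha e (by simpa [h2] using he)
        · exact hA e h2
      · rw [if_neg ha]; split_ifs <;> positivity
    · rw [if_neg (mt h1.1 hC), if_neg hC]
  · push Not at h
    refine le_trans (le_of_eq ?_) (codeWeight_pos hv b 𝒞 A).le
    refine Finset.sum_eq_zero fun C _ => ?_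
    split_ifs with h1
    · exact if_neg (h C h1)
    · rfl

/-- A pair of states, each with a vector. -/
abbrev Quad (c : ℕ) : Type :=
  (Finset (Fin c) × Finset (Fin c)) × ((Fin c → ZMod 2) × (Fin c → ZMod 2))

open Classical in
/-- The weight of a pair of states with vectors from `𝒞`, normalised to total mass one. -/
noncomputable def quadWeight (v : ℝ) (b : Prop) (𝒞 : Submodule (ZMod 2) (Fin c → ZMod 2)) (q : Quad c) : ℝ :=
  (if q.2.1 ∈ 𝒞 then jointWeight v b q.2.1 q.1.1 else 0) *
    (if q.2.2 ∈ 𝒞 then jointWeight v b q.2.2 q.1.2 else 0) / (∑ A, codeWeight v b 𝒞 A) ^ 2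

include hv in
lemma quadWeight_nonneg (q : Quad c) : 0 ≤ quadWeight v b 𝒞 q := by
  have h1 := jointWeight_nonneg hv b q.2.1 q.1.1
  have h2 := jointWeight_nonneg hv b q.2.2 q.1.2
  unfold quadWeight
  refine div_nonneg (mul_nonneg ?_ ?_) (by positivity) <;> split_ifs <;> first | assumption | rfl

lemma sum_quadWeight (A B : Finset (Fin c)) :
    ∑ x, quadWeight v b 𝒞 ((A, B), x) =
      (codeWeight v b 𝒞 A / ∑ A, codeWeight v b 𝒞 A) *
        (codeWeight v b 𝒞 B / ∑ A, codeWeight v b 𝒞 A) := by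
  classical
  rw [Fintype.sum_prod_type]
  simp only [quadWeight, ← Finset.sum_div, ← Finset.mul_sum, ← Finset.sum_mul]
  rw [div_mul_div_comm, ← sq]
  rfl

/-- Exchange the two components on a set that depends on the sum of the two vectors. -/
noncomputable def exchange (T : (Fin c → ZMod 2) → Finset (Fin c)) (q : Quad c) : Quad c :=
  ((mix (T (q.2.1 + q.2.2)) q.1.1 q.1.2, mix (T (q.2.1 + q.2.2)) q.1.2 q.1.1),
    (mixVec (T (q.2.1 + q.2.2)) q.2.1 q.2.2, mixVec (T (q.2.1 + q.2.2)) q.2.2 q.2.1))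

/-- The exchange leaves the sum of the two vectors unchanged, so the second application uses the
same set `T`. Quads carry arbitrary vectors, not only code words, so that this holds on the whole
type. -/
lemma exchange_involutive (T : (Fin c → ZMod 2) → Finset (Fin c)) :
    Function.Involutive (exchange T) := by
  intro q
  simp only [exchange, mixVec_add_mixVec, mix_mix, mixVec_mixVec]

open Classical in
include hv in
lemma quadWeight_exchange_le {T : (Fin c → ZMod 2) → Finset (Fin c)}
    {𝒬 : Finset ((Fin c → ZMod 2) ⧸ 𝒞)} (hT : ∀ D ∈ 𝒞, 𝒞.mkQ (restrictTo (T D) D) ∈ 𝒬)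
    (q : Quad c) :
    quadWeight v b 𝒞 (exchange T q) ≤
      (∑ κ ∈ 𝒬, (if 𝒞.mkQ q.2.1 = κ then jointWeight v b q.2.1 q.1.1 else 0) *
        (if 𝒞.mkQ q.2.2 = κ then jointWeight v b q.2.2 q.1.2 else 0)) /
        (∑ A, codeWeight v b 𝒞 A) ^ 2 := by
  obtain ⟨⟨A, B⟩, ⟨I, F⟩⟩ := q
  have hnn : ∀ κ ∈ 𝒬, 0 ≤ (if 𝒞.mkQ I = κ then jointWeight v b I A else 0) *
        (if 𝒞.mkQ F = κ then jointWeight v b F B else 0) := by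
    intro κ _
    have h1 := jointWeight_nonneg hv b I A
    have h2 := jointWeight_nonneg hv b F B
    refine mul_nonneg ?_ ?_ <;> split_ifs <;> first | assumption | rfl
  unfold quadWeight
  refine div_le_div_of_nonneg_right ?_ (by positivity)
  obtain ⟨S, hS⟩ : ∃ S, S = T (I + F) := ⟨_, rfl⟩
  change (if mixVec (T (I + F)) I F ∈ 𝒞 then
      jointWeight v b (mixVec (T (I + F)) I F) (mix (T (I + F)) A B) else 0) *
    (if mixVec (T (I + F)) F I ∈ 𝒞 then
      jointWeight v b (mixVec (T (I + F)) F I) (mix (T (I + F)) B A) else 0) ≤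
    ∑ κ ∈ 𝒬, (if 𝒞.mkQ I = κ then jointWeight v b I A else 0) *
        (if 𝒞.mkQ F = κ then jointWeight v b F B else 0)
  rw [← hS, ite_zero_mul_ite_zero]
  split_ifs with h
  · obtain ⟨h1, h2⟩ := h
    have hD : I + F ∈ 𝒞 := by
      rw [← mixVec_add_mixVec S I F]; exact 𝒞.add_mem h1 h2
    -- If swapping on `S` lands in `𝒞`, the original vector is congruent to `I + F` restricted to
    -- `S`. This is symmetric in the two vectors, so a single coset `κ` serves both.
    have key : ∀ X Y : Fin c → ZMod 2, X + Y = I + F → mixVec S X Y ∈ 𝒞 →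
        𝒞.mkQ X = 𝒞.mkQ (restrictTo S (I + F)) := by
      intro X Y hXY hX
      rw [mixVec_eq_add, hXY] at hX
      rw [← sub_eq_zero, ← map_sub, Submodule.mkQ_apply, Submodule.Quotient.mk_eq_zero]
      convert hX using 1
      ext e
      simp [CharTwo.sub_eq_add]
    have hI := key I F rfl h1
    have hF := key F I (add_comm _ _) h2
    rw [jointWeight_mix]
    refine le_trans (le_of_eq ?_) (Finset.single_le_sum hnn (hT _ hD))
    rw [← hS, if_pos hI, if_pos hF]
  · exact Finset.sum_nonneg hnn

open Classical in
include hv in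
/-- The weight of the pairs whose exchange has first state `M` is at most the probability of `M`
times the number of cosets involved. -/
lemma sum_quadWeight_mix_le {T : (Fin c → ZMod 2) → Finset (Fin c)}
    {𝒬 : Finset ((Fin c → ZMod 2) ⧸ 𝒞)} (hT : ∀ D ∈ 𝒞, 𝒞.mkQ (restrictTo (T D) D) ∈ 𝒬)
    (M : Finset (Fin c)) :
    (∑ q : Quad c, if mix (T (q.2.1 + q.2.2)) q.1.1 q.1.2 = M then quadWeight v b 𝒞 q else 0) ≤
      codeWeight v b 𝒞 M / (∑ A, codeWeight v b 𝒞 A) * 𝒬.card := by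
  set N := ∑ A, codeWeight v b 𝒞 A with hN
  have hNpos : 0 < N := Finset.sum_pos (fun A _ => codeWeight_pos hv b 𝒞 A) Finset.univ_nonempty
  -- After reindexing by the involution, the constraint only fixes the first state to be `M`; the
  -- second state becomes free and its sum cancels one normalising factor.
  rw [← Equiv.sum_comp ((exchange_involutive T).toPerm (exchange T))]
  have h1 : ∀ q : Quad c,
      (if mix (T ((exchange T q).2.1 + (exchange T q).2.2)) (exchange T q).1.1
        (exchange T q).1.2 = M then quadWeight v b 𝒞 (exchange T q) else 0) ≤
      if q.1.1 = M then
      (∑ κ ∈ 𝒬, (if 𝒞.mkQ q.2.1 = κ then jointWeight v b q.2.1 q.1.1 else 0) *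
        (if 𝒞.mkQ q.2.2 = κ then jointWeight v b q.2.2 q.1.2 else 0)) / N ^ 2 else 0 := by
    intro q
    have : mix (T ((exchange T q).2.1 + (exchange T q).2.2)) (exchange T q).1.1
        (exchange T q).1.2 = q.1.1 := by
      simp only [exchange, mixVec_add_mixVec, mix_mix]
    rw [this]
    split_ifs
    · exact quadWeight_exchange_le hv b 𝒞 hT q
    · rfl
  refine (Finset.sum_le_sum fun q _ => h1 q).trans ?_
  rw [Fintype.sum_prod_type, Fintype.sum_prod_type]
  rw [Finset.sum_eq_single M (fun A _ hA => by simp [hA]) (by simp)]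
  simp only [if_true]
  have h2 : ∀ κ : (Fin c → ZMod 2) ⧸ 𝒞, ∀ B : Finset (Fin c),
      (∑ x : (Fin c → ZMod 2) × (Fin c → ZMod 2),
        (if 𝒞.mkQ x.1 = κ then jointWeight v b x.1 M else 0) *
        (if 𝒞.mkQ x.2 = κ then jointWeight v b x.2 B else 0)) ≤
        codeWeight v b 𝒞 M * codeWeight v b 𝒞 B := by
    intro κ B
    rw [Fintype.sum_prod_type]
    simp only [← Finset.mul_sum, ← Finset.sum_mul]
    refine mul_le_mul (coset_weight_le hv b 𝒞 κ M) (coset_weight_le hv b 𝒞 κ B) ?_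
      (codeWeight_pos hv b 𝒞 M).le
    refine Finset.sum_nonneg fun C _ => ?_
    split_ifs
    · exact jointWeight_nonneg hv b C B
    · rfl
  calc _ = (∑ B, ∑ κ ∈ 𝒬, ∑ x : (Fin c → ZMod 2) × (Fin c → ZMod 2),
        (if 𝒞.mkQ x.1 = κ then jointWeight v b x.1 M else 0) *
        (if 𝒞.mkQ x.2 = κ then jointWeight v b x.2 B else 0)) / N ^ 2 := by
          rw [Finset.sum_div]
          refine Finset.sum_congr rfl fun B _ => ?_
          rw [← Finset.sum_div, Finset.sum_comm]
    _ ≤ (∑ B, ∑ κ ∈ 𝒬, codeWeight v b 𝒞 M * codeWeight v b 𝒞 B) / N ^ 2 := by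
          gcongr with B _ κ _
          exact h2 κ B
    _ = _ := by
          simp only [Finset.sum_const, nsmul_eq_mul, ← Finset.mul_sum, ← hN]
          field_simp

end Abstract

/-! ### Transition probabilities of the Metropolis chain -/

section Metropolis

variable {c : ℕ} {φ : Finset (Fin c) → ℝ}

lemma metropolis_of_symmDiff {A B : Finset (Fin c)} {e : Fin c} (h : symmDiff A B = {e}) :
    metropolis φ A B = 1 / (2 * (c : ℝ)) * min 1 (φ B / φ A) := by
  simp [metropolis, h]

lemma half_le_metropolis_self (hc : 0 < c) (A : Finset (Fin c)) :
    1 / 2 ≤ metropolis φ A A := by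
  have hc' : (0 : ℝ) < c := by exact_mod_cast hc
  have h : ∑ e : Fin c, min 1 (φ (symmDiff A {e}) / φ A) ≤ c := by
    refine (Finset.sum_le_sum fun e _ => min_le_left 1 _).trans ?_
    simp
  have h2 : 1 / (2 * (c : ℝ)) * ∑ e : Fin c, min 1 (φ (symmDiff A {e}) / φ A) ≤
      1 / (2 * (c : ℝ)) * c := by gcongr
  have h3 : 1 / (2 * (c : ℝ)) * c = 1 / 2 := by field_simp
  simp only [metropolis, symmDiff_self, Finset.bot_eq_empty, Finset.card_empty, zero_ne_one,
    if_false, if_true]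
  linarith

lemma eq_or_symmDiff_of_metropolis_pos {A B : Finset (Fin c)} (h : 0 < metropolis φ A B) :
    A = B ∨ ∃ e, symmDiff A B = {e} := by
  unfold metropolis at h
  split_ifs at h with h1 h2
  · exact Or.inr (Finset.card_eq_one.1 h1)
  · exact Or.inl h2
  · exact absurd h (lt_irrefl _)

lemma mul_metropolis_of_symmDiff (hφ : ∀ A, 0 < φ A) {A B : Finset (Fin c)} {e : Fin c}
    (h : symmDiff A B = {e}) :
    φ A * metropolis φ A B = 1 / (2 * (c : ℝ)) * min (φ A) (φ B) := by
  rw [metropolis_of_symmDiff h, mul_left_comm, mul_min_of_nonneg _ _ (hφ A).le, mul_one,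
    mul_div_cancel₀ _ (hφ A).ne']

end Metropolis

/-! ### The flow along exchange paths and its congestion -/

section Flow

variable {c : ℕ}

/-- The first `t` elements in the order `σ`. -/
def initialSeg (σ : Equiv.Perm (Fin c)) (t : ℕ) : Finset (Fin c) :=
  Finset.univ.filter fun e => (σ e : ℕ) < t

lemma symmDiff_mix_subset (σ : Equiv.Perm (Fin c)) (e : Fin c) (A B : Finset (Fin c)) :
    symmDiff (mix (initialSeg σ (σ e)) A B) (mix (initialSeg σ (σ e + 1)) A B) ⊆ {e} := by
  intro x hx
  by_contra hne
  have hne' : (σ x : ℕ) ≠ σ e := fun h =>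
    hne (Finset.mem_singleton.2 (σ.injective (Fin.ext h)))
  have : x ∈ initialSeg σ (σ e) ↔ x ∈ initialSeg σ (σ e + 1) := by
    simp only [initialSeg, Finset.mem_filter, Finset.mem_univ, true_and]; omega
  by_cases h : x ∈ initialSeg σ (σ e)
  · simp [Finset.mem_symmDiff, mem_mix, h, this.1 h] at hx
  · simp [Finset.mem_symmDiff, mem_mix, h, mt this.2 h] at hx

/-- The path that exchanges the coordinates one at a time, in an order that depends on the sum
of the two vectors. -/
noncomputable def exchangePath (σ : (Fin c → ZMod 2) → Equiv.Perm (Fin c)) (q : Quad c) :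
    StateSeq (Finset (Fin c)) :=
  ⟨c, fun t => mix (initialSeg (σ (q.2.1 + q.2.2)) t) q.1.1 q.1.2⟩

variable (σ : (Fin c → ZMod 2) → Equiv.Perm (Fin c)) (q : Quad c)

lemma exchangePath_zero : (exchangePath σ q).2 0 = q.1.1 := by
  ext e; simp [exchangePath, mem_mix, initialSeg]

lemma exchangePath_last : (exchangePath σ q).2 (Fin.last _) = q.1.2 := by
  ext e; simp [exchangePath, mem_mix, initialSeg]

lemma isPath_exchangePath {φ : Finset (Fin c) → ℝ} (hφ : ∀ A, 0 < φ A) :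
    IsPath (metropolis φ) (exchangePath σ q) := by
  intro i
  have hc : 0 < c := i.pos
  have hc' : (0 : ℝ) < c := by exact_mod_cast hc
  obtain ⟨e, he⟩ := (σ (q.2.1 + q.2.2)).surjective i
  have h := symmDiff_mix_subset (σ (q.2.1 + q.2.2)) e q.1.1 q.1.2
  rw [he] at h
  rcases Finset.subset_singleton_iff.1 h with h | h
  · have h' : (exchangePath σ q).2 i.castSucc = (exchangePath σ q).2 i.succ := symmDiff_eq_bot.1 h
    rw [h']
    exact lt_of_lt_of_le one_half_pos (half_le_metropolis_self hc _)
  · have h' : symmDiff ((exchangePath σ q).2 i.castSucc) ((exchangePath σ q).2 i.succ) = _ := h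
    rw [metropolis_of_symmDiff h']
    have := hφ ((exchangePath σ q).2 i.castSucc)
    have := hφ ((exchangePath σ q).2 i.succ)
    positivity

/-- If the path makes the step `(Z, Z')`, it does so when it treats some coordinate `e`, the
only one in which `Z` and `Z'` can differ. -/
lemma exists_of_exchangePath_step {Z Z' : Finset (Fin c)}
    (h : ∃ i : Fin (exchangePath σ q).1, (exchangePath σ q).2 i.castSucc = Z ∧
      (exchangePath σ q).2 i.succ = Z') :
    ∃ e, symmDiff Z Z' ⊆ {e} ∧
      mix (initialSeg (σ (q.2.1 + q.2.2)) (σ (q.2.1 + q.2.2) e)) q.1.1 q.1.2 = Z ∧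
      mix (initialSeg (σ (q.2.1 + q.2.2)) (σ (q.2.1 + q.2.2) e + 1)) q.1.1 q.1.2 = Z' := by
  obtain ⟨i, h1, h2⟩ := h
  obtain ⟨e, rfl⟩ := (σ (q.2.1 + q.2.2)).surjective i
  refine ⟨e, ?_, h1, h2⟩
  rw [← h1, ← h2]
  exact symmDiff_mix_subset (σ (q.2.1 + q.2.2)) e q.1.1 q.1.2

variable (v : ℝ) (b : Prop) (𝒞 : Submodule (ZMod 2) (Fin c → ZMod 2))

open Classical in
/-- The flow along the exchange paths. -/
noncomputable def exchangeFlow (γ : StateSeq (Finset (Fin c))) : ℝ≥0 :=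
  ∑ q : Quad c, if exchangePath σ q = γ then (quadWeight v b 𝒞 q).toNNReal else 0

-- Sums over paths become finite sums over quads, since each quad puts its weight on one path.
open Classical in
lemma tsum_exchangeFlow_mul (S : Set (StateSeq (Finset (Fin c))))
    (w : StateSeq (Finset (Fin c)) → ℝ≥0∞) :
    ∑' γ : S, (exchangeFlow σ v b 𝒞 γ : ℝ≥0∞) * w γ =
      ∑ q : Quad c, if exchangePath σ q ∈ S then
        ENNReal.ofReal (quadWeight v b 𝒞 q) * w (exchangePath σ q) else 0 := by
  simp only [exchangeFlow, ENNReal.ofNNReal_finsetSum, Finset.sum_mul]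
  rw [Summable.tsum_finsetSum fun _ _ => ENNReal.summable]
  refine Finset.sum_congr rfl fun q _ => ?_
  rw [tsum_subtype S fun γ => ((if exchangePath σ q = γ then
    (quadWeight v b 𝒞 q).toNNReal else 0 : ℝ≥0) : ℝ≥0∞) * w γ]
  rw [tsum_eq_single (exchangePath σ q)]
  · by_cases h : exchangePath σ q ∈ S
    · simp [Set.indicator, h, ENNReal.ofReal]
    · simp [Set.indicator, h]
  · intro γ hγ
    simp [Set.indicator, Ne.symm hγ]

variable {v} {φ : Finset (Fin c) → ℝ}

theorem isFlow_exchangeFlow (hv : 0 < v)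
    (hφ : ∀ A, φ A = codeWeight v b 𝒞 A / ∑ B, codeWeight v b 𝒞 B) :
    IsFlow (metropolis φ) φ (exchangeFlow σ v b 𝒞) := by
  classical
  have hN : 0 < ∑ B, codeWeight v b 𝒞 B :=
    Finset.sum_pos (fun A _ => codeWeight_pos hv b 𝒞 A) Finset.univ_nonempty
  have hpos : ∀ A, 0 < φ A := fun A => by
    rw [hφ]; exact div_pos (codeWeight_pos hv b 𝒞 A) hN
  have hsum : ∑ A, φ A = 1 := by
    simp only [hφ, ← Finset.sum_div]; exact div_self hN.ne'
  refine ⟨fun γ => ?_, fun A B _ => ?_⟩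
  · have h1 : ∑ q : Quad c, quadWeight v b 𝒞 q = 1 := by
      rw [Fintype.sum_prod_type, Fintype.sum_prod_type]
      simp only [sum_quadWeight, ← hφ, ← Finset.mul_sum, hsum, mul_one]
    calc exchangeFlow σ v b 𝒞 γ ≤ ∑ q : Quad c, (quadWeight v b 𝒞 q).toNNReal := by
          refine Finset.sum_le_sum fun q _ => ?_
          split_ifs
          · rfl
          · exact zero_le
      _ = 1 := by
          rw [← Real.toNNReal_sum_of_nonneg fun q _ => quadWeight_nonneg hv b 𝒞 q, h1,
            Real.toNNReal_one]
  · have h := tsum_exchangeFlow_mul σ v b 𝒞 (pathsBetween (metropolis φ) A B) (fun _ => 1)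
    simp only [mul_one] at h
    rw [h]
    have h2 : ∀ q : Quad c, exchangePath σ q ∈ pathsBetween (metropolis φ) A B ↔ q.1 = (A, B) := by
      intro q
      simp only [pathsBetween, Set.mem_ofPred_eq, isPath_exchangePath σ q hpos, true_and,
        exchangePath_zero, exchangePath_last, Prod.ext_iff]
    simp only [h2]
    rw [Fintype.sum_prod_type, Finset.sum_eq_single (A, B)]
    · simp only [if_true]
      rw [← ENNReal.ofReal_sum_of_nonneg fun x _ => quadWeight_nonneg hv b 𝒞 _, sum_quadWeight,
        ← hφ, ← hφ]
    · intro x _ hx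
      simp [hx]
    · simp

/-- If the restrictions of the code words to the initial segments of their orders meet only the
cosets in `𝒬`, then the congestion of the exchange flow is at most `2 c² |𝒬|`. -/
theorem congestion_exchangeFlow_le (hv : 0 < v)
    (hφ : ∀ A, φ A = codeWeight v b 𝒞 A / ∑ B, codeWeight v b 𝒞 B)
    {𝒬 : Finset ((Fin c → ZMod 2) ⧸ 𝒞)}
    (hσ : ∀ D ∈ 𝒞, ∀ t, 𝒞.mkQ (restrictTo (initialSeg (σ D) t) D) ∈ 𝒬) :
    congestion (metropolis φ) φ (exchangeFlow σ v b 𝒞) ≤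
      ENNReal.ofReal (2 * (c : ℝ) ^ 2 * 𝒬.card) := by
  classical
  have hN : 0 < ∑ B, codeWeight v b 𝒞 B :=
    Finset.sum_pos (fun A _ => codeWeight_pos hv b 𝒞 A) Finset.univ_nonempty
  have hpos : ∀ A, 0 < φ A := fun A => by
    rw [hφ]; exact div_pos (codeWeight_pos hv b 𝒞 A) hN
  have hw := quadWeight_nonneg hv b 𝒞
  refine iSup_le fun Z => iSup_le fun Z' => iSup_le fun hP => ?_
  refine ENNReal.div_le_of_le_mul ?_
  rw [tsum_exchangeFlow_mul σ v b 𝒞 _ fun γ => (γ.1 : ℝ≥0∞), ← ENNReal.ofReal_mul (by positivity)]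
  have hlhs : (∑ q : Quad c, if exchangePath σ q ∈ pathsThrough (metropolis φ) Z Z' then
        ENNReal.ofReal (quadWeight v b 𝒞 q) * ((exchangePath σ q).1 : ℝ≥0∞) else 0) =
      ENNReal.ofReal (c * ∑ q : Quad c,
        if exchangePath σ q ∈ pathsThrough (metropolis φ) Z Z' then quadWeight v b 𝒞 q else 0) := by
    rw [Finset.mul_sum, ENNReal.ofReal_sum_of_nonneg]
    · refine Finset.sum_congr rfl fun q _ => ?_
      split_ifs
      · rw [ENNReal.ofReal_mul (Nat.cast_nonneg c), ENNReal.ofReal_natCast, mul_comm]; rfl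
      · simp
    · intro q _
      split_ifs
      · exact mul_nonneg (Nat.cast_nonneg c) (hw q)
      · simp
  rw [hlhs]
  refine ENNReal.ofReal_le_ofReal ?_
  rcases Nat.eq_zero_or_pos c with rfl | hc
  · simp
  have hc' : (0 : ℝ) < c := by exact_mod_cast hc
  -- For fixed `e`, the set treated before `e` depends on `D` alone, as the exchange bound requires.
  -- `hpost` is the analogue just after `e`.
  have hpre : ∀ e, (∑ q : Quad c,
      if mix (initialSeg (σ (q.2.1 + q.2.2)) (σ (q.2.1 + q.2.2) e)) q.1.1 q.1.2 = Z then
        quadWeight v b 𝒞 q else 0) ≤ φ Z * 𝒬.card := fun e => by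
    rw [hφ]
    exact sum_quadWeight_mix_le hv b 𝒞 (T := fun D => initialSeg (σ D) (σ D e))
      (fun D hD => hσ D hD _) Z
  have hpost : ∀ e, (∑ q : Quad c,
      if mix (initialSeg (σ (q.2.1 + q.2.2)) (σ (q.2.1 + q.2.2) e + 1)) q.1.1 q.1.2 = Z' then
        quadWeight v b 𝒞 q else 0) ≤ φ Z' * 𝒬.card := fun e => by
    rw [hφ]
    exact sum_quadWeight_mix_le hv b 𝒞 (T := fun D => initialSeg (σ D) (σ D e + 1))
      (fun D hD => hσ D hD _) Z'
  -- A holding step may occur at any of the `c` coordinates; this extra factor `c` is offset by a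
  -- holding probability of at least `1/2`. A proper step determines `e`, and bounding the mass at
  -- both ends gives the minimum of `φ Z` and `φ Z'` that appears in `φ Z * P(Z, Z')`.
  rcases eq_or_symmDiff_of_metropolis_pos hP with rfl | ⟨e, he⟩
  · have h1 : (∑ q : Quad c, if exchangePath σ q ∈ pathsThrough (metropolis φ) Z Z then
        quadWeight v b 𝒞 q else 0) ≤ c * (φ Z * 𝒬.card) := by
      calc _ ≤ ∑ q : Quad c, ∑ e, if mix (initialSeg (σ (q.2.1 + q.2.2))
              (σ (q.2.1 + q.2.2) e)) q.1.1 q.1.2 = Z then quadWeight v b 𝒞 q else 0 := by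
            refine Finset.sum_le_sum fun q _ => ?_
            have hnn : ∀ e ∈ Finset.univ, 0 ≤ if mix (initialSeg (σ (q.2.1 + q.2.2))
                (σ (q.2.1 + q.2.2) e)) q.1.1 q.1.2 = Z then quadWeight v b 𝒞 q else 0 := by
              intro e _
              split_ifs
              exacts [hw q, le_rfl]
            split_ifs with h
            · obtain ⟨e, -, h1, -⟩ := exists_of_exchangePath_step σ q h.2
              refine le_trans (le_of_eq ?_) (Finset.single_le_sum hnn (Finset.mem_univ e))
              rw [if_pos h1]
            · exact Finset.sum_nonneg hnn
        _ = ∑ e, ∑ q : Quad c, if mix (initialSeg (σ (q.2.1 + q.2.2))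
              (σ (q.2.1 + q.2.2) e)) q.1.1 q.1.2 = Z then quadWeight v b 𝒞 q else 0 :=
            Finset.sum_comm
        _ ≤ ∑ _e : Fin c, φ Z * 𝒬.card := Finset.sum_le_sum fun e _ => hpre e
        _ = _ := by simp
    calc _ ≤ c * (c * (φ Z * 𝒬.card)) := by gcongr
      _ = 2 * (c : ℝ) ^ 2 * 𝒬.card * (φ Z * (1 / 2)) := by ring
      _ ≤ _ := by
        have := hpos Z
        have := half_le_metropolis_self (φ := φ) hc Z
        gcongr
  · have huse : ∀ q : Quad c, exchangePath σ q ∈ pathsThrough (metropolis φ) Z Z' →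
        mix (initialSeg (σ (q.2.1 + q.2.2)) (σ (q.2.1 + q.2.2) e)) q.1.1 q.1.2 = Z ∧
        mix (initialSeg (σ (q.2.1 + q.2.2)) (σ (q.2.1 + q.2.2) e + 1)) q.1.1 q.1.2 = Z' := by
      intro q h
      obtain ⟨e', he', h1, h2⟩ := exists_of_exchangePath_step σ q h.2
      rw [he, Finset.singleton_subset_singleton] at he'
      subst he'
      exact ⟨h1, h2⟩
    have h1 : (∑ q : Quad c, if exchangePath σ q ∈ pathsThrough (metropolis φ) Z Z' then
        quadWeight v b 𝒞 q else 0) ≤ min (φ Z) (φ Z') * 𝒬.card := by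
      rw [min_mul_of_nonneg _ _ (Nat.cast_nonneg _), le_min_iff]
      constructor
      · refine le_trans (Finset.sum_le_sum fun q _ => ?_) (hpre e)
        split_ifs with h h' h'
        exacts [le_rfl, absurd (huse q h).1 h', hw q, le_rfl]
      · refine le_trans (Finset.sum_le_sum fun q _ => ?_) (hpost e)
        split_ifs with h h' h'
        exacts [le_rfl, absurd (huse q h).2 h', hw q, le_rfl]
    rw [mul_metropolis_of_symmDiff hpos he]
    calc _ ≤ c * (min (φ Z) (φ Z') * 𝒬.card) := by gcongr
      _ = _ := by field_simp

end Flow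

/-! ### Ordering the edges of an even subgraph -/

section Order

variable {c m : ℕ}

/-- The order is built from its end: a removable element takes the last position, and induction
orders the rest. -/
lemma exists_position {𝓕 : Finset (Fin c) → Prop}
    (h𝓕 : ∀ S, 𝓕 S → S.Nonempty → ∃ e ∈ S, 𝓕 (S.erase e)) (k : ℕ) :
    ∀ S : Finset (Fin c), S.card = k → 𝓕 S → ∃ pos : Fin c → ℕ,
      Set.InjOn pos S ∧ (∀ e ∈ S, pos e < k) ∧ ∀ t, 𝓕 (S.filter fun e => pos e < t) := by
  induction k with
  | zero =>
    intro S hS hF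
    rw [Finset.card_eq_zero] at hS
    subst hS
    exact ⟨fun _ => 0, by simp, by simp, by simpa using hF⟩
  | succ k ih =>
    intro S hS hF
    obtain ⟨e, he, heF⟩ := h𝓕 S hF (Finset.card_pos.1 (by omega))
    obtain ⟨pos, hinj, hlt, hpos⟩ := ih (S.erase e) (by rw [Finset.card_erase_of_mem he]; omega) heF
    have hu : ∀ x, x ≠ e → Function.update pos e k x = pos x := fun x hx =>
      Function.update_of_ne hx _ _
    have hue : Function.update pos e k e = k := Function.update_self _ _ _
    refine ⟨Function.update pos e k, ?_, ?_, ?_⟩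
    · intro x hx y hy hxy
      by_cases h1 : x = e <;> by_cases h2 : y = e
      · rw [h1, h2]
      · subst h1
        rw [hue, hu y h2] at hxy
        exact absurd hxy (hlt y (Finset.mem_erase.2 ⟨h2, hy⟩)).ne'
      · subst h2
        rw [hue, hu x h1] at hxy
        exact absurd hxy (hlt x (Finset.mem_erase.2 ⟨h1, hx⟩)).ne
      · rw [hu x h1, hu y h2] at hxy
        exact hinj (by simpa using ⟨hx, h1⟩) (by simpa using ⟨hy, h2⟩) hxy
    · intro x hx
      by_cases h1 : x = e
      · subst h1; rw [hue]; omega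
      · rw [hu x h1]; exact (hlt x (Finset.mem_erase.2 ⟨h1, hx⟩)).trans (Nat.lt_succ_self k)
    · intro t
      rcases Nat.lt_or_ge k t with ht | ht
      · rw [Finset.filter_true_of_mem]
        · exact hF
        · intro x hx
          by_cases h1 : x = e
          · subst h1; rwa [hue]
          · rw [hu x h1]; exact (hlt x (Finset.mem_erase.2 ⟨h1, hx⟩)).trans ht
      · convert hpos t using 1
        ext x
        by_cases h1 : x = e
        · subst h1; simp [ht]
        · simp [h1]

/-- In an accessible family of sets that contains the whole ground set, some order has all its
initial segments in the family. -/
lemma exists_perm_initialSeg {𝓕 : Finset (Fin c) → Prop}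
    (h𝓕 : ∀ S, 𝓕 S → S.Nonempty → ∃ e ∈ S, 𝓕 (S.erase e)) (huniv : 𝓕 Finset.univ) :
    ∃ σ : Equiv.Perm (Fin c), ∀ t, 𝓕 (initialSeg σ t) := by
  obtain ⟨pos, hinj, hlt, hpos⟩ := exists_position h𝓕 c Finset.univ (by simp) huniv
  have hbij : Function.Bijective fun e : Fin c => (⟨pos e, hlt e (Finset.mem_univ e)⟩ : Fin c) :=
    Finite.injective_iff_bijective.1 fun x y hxy =>
      hinj (by simp) (by simp) (by simpa using hxy)
  exact ⟨Equiv.ofBijective _ hbij, hpos⟩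

/-- The vectors with at most two odd vertices. -/
def pairBoundaries (m : ℕ) : Finset (Fin m → ZMod 2) :=
  -- Equal pairs already give `0` unless `m = 0`; the insertion covers that case.
  insert 0 (Finset.univ.image fun x : Fin m × Fin m => Pi.single x.1 1 + Pi.single x.2 1)

lemma card_pairBoundaries_le : (pairBoundaries m).card ≤ m ^ 2 + 1 := by
  refine (Finset.card_insert_le _ _).trans (Nat.add_le_add_right ?_ 1)
  refine Finset.card_image_le.trans ?_
  simp [sq]

lemma single_add_single_mem (u w : Fin m) :
    (Pi.single u 1 + Pi.single w 1 : Fin m → ZMod 2) ∈ pairBoundaries m :=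
  Finset.mem_insert_of_mem (Finset.mem_image.2 ⟨(u, w), Finset.mem_univ _, rfl⟩)

lemma pi_add_self (x : Fin m → ZMod 2) : x + x = 0 := by
  ext i; exact CharTwo.add_self_eq_zero _

lemma IsEdgeVertexIncidence.exists_row {g : Matrix (Fin c) (Fin m) (ZMod 2)}
    (hg : IsEdgeVertexIncidence g) (e : Fin c) :
    ∃ u w : Fin m, g e = Pi.single u 1 + Pi.single w 1 := by
  classical
  obtain ⟨G, -, hE, hG⟩ := hg
  obtain ⟨u, w, h⟩ := Graph.exists_isLink_of_mem_edgeSet (G := G) (e := e) (by rw [hE]; trivial)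
  refine ⟨u, w, ?_⟩
  ext x
  rw [hG]
  have hx : G.IsNonloopAt e x ↔ u ≠ w ∧ (x = u ∨ x = w) := by
    constructor
    · rintro ⟨y, hyx, hl⟩
      rcases (h.isLink_iff).1 hl with ⟨h1, h2⟩ | ⟨h1, h2⟩
      · subst h1 h2; exact ⟨hyx.symm, Or.inl rfl⟩
      · subst h1 h2; exact ⟨hyx, Or.inr rfl⟩
    · rintro ⟨hne, rfl | rfl⟩
      · exact ⟨w, hne.symm, h⟩
      · exact ⟨u, hne, h.symm⟩
  by_cases huw : u = w
  · subst huw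
    rw [if_neg (by simp [hx]), pi_add_self]; rfl
  · by_cases h1 : x = u
    · subst h1; simp [hx, huw]
    · by_cases h2 : x = w
      · subst h2; simp [hx, huw, h1]
      · simp [hx, h1, h2]

/-- Coordinates where `D` vanishes can be dropped freely. Otherwise, with no odd vertex any edge may
go, leaving its ends as the odd vertices; with odd vertices `u ≠ w`, deleting an edge at `u` moves
the odd vertex to its other end. -/
lemma exists_erase_mem_pairBoundaries {g : Matrix (Fin c) (Fin m) (ZMod 2)}
    (hg : ∀ e, ∃ u w : Fin m, g e = Pi.single u 1 + Pi.single w 1) (D : Fin c → ZMod 2)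
    (S : Finset (Fin c)) (hS : gᵀ *ᵥ restrictTo S D ∈ pairBoundaries m) (hne : S.Nonempty) :
    ∃ e ∈ S, gᵀ *ᵥ restrictTo (S.erase e) D ∈ pairBoundaries m := by
  by_cases hD : ∃ e ∈ S, D e = 0
  · obtain ⟨e, he, hDe⟩ := hD
    refine ⟨e, he, ?_⟩
    convert hS using 2
    ext x
    by_cases hx : x = e
    · subst hx; simp [restrictTo, hDe]
    · simp [restrictTo, hx]
  push Not at hD
  have hD1 : ∀ e ∈ S, D e = 1 := fun e he => by
    have h := hD e he
    generalize D e = d at h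
    revert d; decide
  have herase : ∀ e ∈ S, gᵀ *ᵥ restrictTo (S.erase e) D = gᵀ *ᵥ restrictTo S D + g e := by
    intro e he
    have : restrictTo (S.erase e) D = restrictTo S D + Pi.single e 1 := by
      ext x
      by_cases hx : x = e
      · subst hx; simp [restrictTo, he, hD1 x he, CharTwo.add_self_eq_zero]
      · simp [restrictTo, hx]
    rw [this, Matrix.mulVec_add, Matrix.mulVec_single_one]
    rfl
  have hzero : gᵀ *ᵥ restrictTo S D = 0 → ∃ e ∈ S, gᵀ *ᵥ restrictTo (S.erase e) D ∈
      pairBoundaries m := by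
    intro h
    obtain ⟨e, he⟩ := hne
    obtain ⟨u, w, huw⟩ := hg e
    refine ⟨e, he, ?_⟩
    rw [herase e he, h, zero_add, huw]
    exact single_add_single_mem u w
  rcases Finset.mem_insert.1 hS with h | h
  · exact hzero h
  obtain ⟨⟨u, w⟩, -, h⟩ := Finset.mem_image.1 h
  simp only at h
  by_cases huw : u = w
  · subst huw
    exact hzero (by rw [← h, pi_add_self])
  have hu : (gᵀ *ᵥ restrictTo S D) u ≠ 0 := by
    rw [← h]; simp [huw]
  -- An odd vertex is incident to some nonloop edge of the subgraph.
  obtain ⟨e, -, he⟩ := Finset.exists_ne_zero_of_sum_ne_zero (show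
    ∑ e, gᵀ u e * restrictTo S D e ≠ 0 from hu)
  have heS : e ∈ S := by
    by_contra hn
    exact he (by simp [restrictTo, hn])
  have hge : g e u ≠ 0 := left_ne_zero_of_mul he
  obtain ⟨x, y, hxy⟩ := hg e
  refine ⟨e, heS, ?_⟩
  rw [herase e heS, ← h, hxy]
  have hcases : u = x ∨ u = y := by
    by_contra hn
    push Not at hn
    exact hge (by rw [hxy]; simp [hn.1, hn.2])
  rcases hcases with rfl | rfl
  · rw [show (Pi.single u 1 + Pi.single w 1 + (Pi.single u 1 + Pi.single y 1) : Fin m → ZMod 2) =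
      (Pi.single u 1 + Pi.single u 1) + (Pi.single w 1 + Pi.single y 1) by abel, pi_add_self,
      zero_add]
    exact single_add_single_mem _ _
  · rw [show (Pi.single u 1 + Pi.single w 1 + (Pi.single x 1 + Pi.single u 1) : Fin m → ZMod 2) =
      (Pi.single u 1 + Pi.single u 1) + (Pi.single w 1 + Pi.single x 1) by abel, pi_add_self,
      zero_add]
    exact single_add_single_mem _ _

/-- The edges can be ordered so that the initial segments of an even subgraph have at most two
odd vertices. -/
lemma exists_perm_pairBoundaries {g : Matrix (Fin c) (Fin m) (ZMod 2)}
    (hg : ∀ e, ∃ u w : Fin m, g e = Pi.single u 1 + Pi.single w 1) {D : Fin c → ZMod 2}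
    (hD : gᵀ *ᵥ D = 0) :
    ∃ σ : Equiv.Perm (Fin c), ∀ t, gᵀ *ᵥ restrictTo (initialSeg σ t) D ∈ pairBoundaries m := by
  refine exists_perm_initialSeg (𝓕 := fun S => gᵀ *ᵥ restrictTo S D ∈ pairBoundaries m)
    (exists_erase_mem_pairBoundaries hg D) ?_
  have : restrictTo Finset.univ D = D := by ext x; simp [restrictTo]
  rw [this, hD]
  exact Finset.mem_insert_self _ _

end Order

/-! ### Counting cosets with prescribed images -/

section Cosets

variable {K V W : Type*} [Field K] [AddCommGroup V] [Module K V] [FiniteDimensional K V]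
  [AddCommGroup W] [Module K W]

lemma finrank_map_add_finrank_ker (f : V →ₗ[K] W) {S : Submodule K V} (hS : LinearMap.ker f ≤ S) :
    Module.finrank K (S.map f) + Module.finrank K (LinearMap.ker f) = Module.finrank K S := by
  have h := LinearMap.finrank_range_add_finrank_ker (f.domRestrict S)
  rw [LinearMap.range_domRestrict, LinearMap.ker_domRestrict,
    (Submodule.comapSubtypeEquivOfLe hS).finrank_eq] at h
  exact h

lemma finrank_comap (f : V →ₗ[K] W) (S : Submodule K W) :
    Module.finrank K (S.comap f) =
      Module.finrank K (LinearMap.range f ⊓ S : Submodule K W) +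
        Module.finrank K (LinearMap.ker f) := by
  rw [← Submodule.map_comap_eq, finrank_map_add_finrank_ker f (LinearMap.ker_le_comap f)]

open Classical in
/-- The number of cosets of `𝒞` that a map vanishing on `𝒞` sends to a given finite set. -/
lemma card_filter_liftQ_le [Fintype K] [Fintype V] (𝒞 : Submodule K V) [Fintype (V ⧸ 𝒞)]
    (f : V →ₗ[K] W)
    (h𝒞 : 𝒞 ≤ LinearMap.ker f) {Δ : ℕ}
    (hΔ : Module.finrank K (LinearMap.ker f) ≤ Module.finrank K 𝒞 + Δ) (B : Finset W) :
    (Finset.univ.filter fun κ : V ⧸ 𝒞 => 𝒞.liftQ f h𝒞 κ ∈ B).card ≤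
      Fintype.card K ^ Δ * B.card := by
  -- The kernel of the induced map is `ker f / 𝒞`, of dimension at most `Δ`; each nonempty fibre is
  -- a translate of it.
  have hker : Fintype.card (LinearMap.ker (𝒞.liftQ f h𝒞)) ≤ Fintype.card K ^ Δ := by
    rw [Module.card_eq_pow_finrank (K := K)]
    refine Nat.pow_le_pow_right Fintype.card_pos ?_
    have h := finrank_map_add_finrank_ker 𝒞.mkQ (S := LinearMap.ker f) (by rwa [Submodule.ker_mkQ])
    rw [Submodule.ker_mkQ] at h
    rw [Submodule.ker_liftQ]
    omega
  refine (Finset.card_le_mul_card_image_of_maps_to (f := 𝒞.liftQ f h𝒞) (t := B)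
    (fun κ hκ => (Finset.mem_filter.1 hκ).2) (Fintype.card K ^ Δ) fun w _ => ?_)
  refine le_trans ?_ hker
  rcases Finset.eq_empty_or_nonempty ((Finset.univ.filter fun κ : V ⧸ 𝒞 =>
    𝒞.liftQ f h𝒞 κ ∈ B).filter fun κ => 𝒞.liftQ f h𝒞 κ = w) with h | ⟨κ₀, h₀⟩
  · rw [h]; simp
  · have h₀' := (Finset.mem_filter.1 h₀).2
    rw [← Finset.card_univ]
    refine Finset.card_le_card_of_injOn
      (fun κ => if hκ : κ - κ₀ ∈ LinearMap.ker (𝒞.liftQ f h𝒞) then ⟨κ - κ₀, hκ⟩ else 0)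
      (fun _ _ => Finset.mem_coe.2 (Finset.mem_univ _)) ?_
    have hmem : ∀ κ ∈ ((Finset.univ.filter fun κ : V ⧸ 𝒞 =>
        𝒞.liftQ f h𝒞 κ ∈ B).filter fun κ => 𝒞.liftQ f h𝒞 κ = w),
        κ - κ₀ ∈ LinearMap.ker (𝒞.liftQ f h𝒞) := fun κ hκ => by
      rw [LinearMap.mem_ker, map_sub, (Finset.mem_filter.1 hκ).2, h₀', sub_self]
    intro x hx y hy hxy
    simp only [dif_pos (hmem x hx), dif_pos (hmem y hy), Subtype.mk.injEq, sub_left_inj] at hxy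
    exact hxy

end Cosets

/-! ### From a graph coupling to a flow -/

section Coupling

variable {c m : ℕ}

/-- A code of small codimension in the cycle space of a graph yields a flow of small congestion. -/
theorem exists_flow_of_incidence {v : ℝ} (hv : 0 < v) (b : Prop)
    (𝒞 : Submodule (ZMod 2) (Fin c → ZMod 2)) {g : Matrix (Fin c) (Fin m) (ZMod 2)}
    (hg : IsEdgeVertexIncidence g) (h𝒞 : 𝒞 ≤ LinearMap.ker gᵀ.mulVecLin) {Δ : ℕ}
    (hΔ : Module.finrank (ZMod 2) (LinearMap.ker gᵀ.mulVecLin) ≤ Module.finrank (ZMod 2) 𝒞 + Δ)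
    {φ : Finset (Fin c) → ℝ} (hφ : ∀ A, φ A = codeWeight v b 𝒞 A / ∑ B, codeWeight v b 𝒞 B) :
    ∃ F : StateSeq (Finset (Fin c)) → ℝ≥0, IsFlow (metropolis φ) φ F ∧
      congestion (metropolis φ) φ F ≤
        ENNReal.ofReal (2 * (c : ℝ) ^ 2 * (2 ^ Δ * ((m : ℝ) ^ 2 + 1))) := by
  classical
  have hex : ∀ D : Fin c → ZMod 2, ∃ σ : Equiv.Perm (Fin c), D ∈ 𝒞 →
      ∀ t, gᵀ *ᵥ restrictTo (initialSeg σ t) D ∈ pairBoundaries m := by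
    intro D
    by_cases hD : D ∈ 𝒞
    · obtain ⟨σ, hσ⟩ := exists_perm_pairBoundaries hg.exists_row (h𝒞 hD)
      exact ⟨σ, fun _ => hσ⟩
    · exact ⟨1, fun h => absurd h hD⟩
  choose σ hσ using hex
  have : Fintype ((Fin c → ZMod 2) ⧸ 𝒞) := Fintype.ofFinite _
  refine ⟨exchangeFlow σ v b 𝒞, isFlow_exchangeFlow σ b 𝒞 hv hφ, ?_⟩
  refine (congestion_exchangeFlow_le σ b 𝒞 hv hφ (𝒬 := Finset.univ.filter fun κ =>
    𝒞.liftQ gᵀ.mulVecLin h𝒞 κ ∈ pairBoundaries m) ?_).trans (ENNReal.ofReal_le_ofReal ?_)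
  · intro D hD t
    rw [Finset.mem_filter]
    exact ⟨Finset.mem_univ _, hσ D hD t⟩
  · have h := (card_filter_liftQ_le 𝒞 gᵀ.mulVecLin h𝒞 hΔ (pairBoundaries m)).trans
      (Nat.mul_le_mul_left _ card_pairBoundaries_le)
    rw [ZMod.card] at h
    have h' : (_ : ℝ) ≤ _ := Nat.cast_le.2 h
    push_cast at h'
    gcongr
    refine le_trans (le_of_eq ?_) h'
    congr!

end Coupling

/-! ### The random-cluster measure as a marginal of code weights -/

section Weights

variable {c n : ℕ}

/-- The vectors supported in `A` (if `b` holds) or in its complement (if not). -/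
def suppSubmodule (b : Prop) (A : Finset (Fin c)) : Submodule (ZMod 2) (Fin c → ZMod 2) where
  carrier := {C | Adm b C A}
  zero_mem' := fun e he => absurd rfl he
  add_mem' := fun {x y} hx hy e he => by
    by_cases h : x e = 0
    · exact hy e (by simpa [h] using he)
    · exact hx e h
  smul_mem' := fun a x hx e he => hx e (right_ne_zero_of_mul he)

lemma mem_suppSubmodule {b : Prop} {A : Finset (Fin c)} {C : Fin c → ZMod 2} :
    C ∈ suppSubmodule b A ↔ Adm b C A := Iff.rfl

lemma codeWeight_eq (v : ℝ) (b : Prop) (𝒞 : Submodule (ZMod 2) (Fin c → ZMod 2))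
    (A : Finset (Fin c)) :
    codeWeight v b 𝒞 A =
      v ^ A.card * 2 ^ Module.finrank (ZMod 2) (𝒞 ⊓ suppSubmodule b A : Submodule _ _) := by
  classical
  have h := Module.card_eq_pow_finrank (K := ZMod 2) (V := (𝒞 ⊓ suppSubmodule b A : Submodule _ _))
  rw [ZMod.card, Fintype.card_subtype] at h
  have h' : (2 : ℝ) ^ Module.finrank (ZMod 2) (𝒞 ⊓ suppSubmodule b A : Submodule _ _) =
      (Finset.univ.filter fun C => C ∈ 𝒞 ⊓ suppSubmodule b A).card := by
    rw [h]; push_cast; rfl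
  rw [h', Finset.card_filter, Nat.cast_sum, Finset.mul_sum, codeWeight]
  refine Finset.sum_congr rfl fun C _ => ?_
  simp only [Submodule.mem_inf, mem_suppSubmodule, jointWeight]
  by_cases h1 : C ∈ 𝒞 <;> by_cases h2 : Adm b C A <;> simp [h1, h2]

lemma rcMeasure_eq_of_rcWeight_eq {h : Matrix (Fin c) (Fin n) (ZMod 2)} {p k : ℝ} (hk : 0 < k)
    {f : Finset (Fin c) → ℝ} (hf : ∀ A, rcWeight h p A = k * f A) (A : Finset (Fin c)) :
    rcMeasure h p A = f A / ∑ B, f B := by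
  simp only [rcMeasure, hf, ← Finset.mul_sum]
  exact mul_div_mul_left _ _ hk.ne'

lemma finrank_ker_add_card {r s : Type*} [Fintype r] [Fintype s] [DecidableEq r]
    [DecidableEq s] (M : Matrix r s (ZMod 2)) :
    Module.finrank (ZMod 2) (LinearMap.ker M.mulVecLin) + Fintype.card r =
      Module.finrank (ZMod 2) (LinearMap.ker Mᵀ.mulVecLin) + Fintype.card s := by
  have h1 := LinearMap.finrank_range_add_finrank_ker M.mulVecLin
  have h2 := LinearMap.finrank_range_add_finrank_ker Mᵀ.mulVecLin
  have h3 : Mᵀ.rank = M.rank := Matrix.rank_transpose M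
  simp only [Matrix.rank] at h3
  rw [Module.finrank_fintype_fun_eq_card] at h1 h2
  omega

/-- Equality of row and column rank trades the kernel of `h_A` for that of its transpose; extension
by zero identifies the latter with the vectors of `ker hᵀ` supported in `A`. -/
lemma kerDim_add_card (h : Matrix (Fin c) (Fin n) (ZMod 2)) (A : Finset (Fin c)) :
    kerDim h A + A.card = Module.finrank (ZMod 2)
      (LinearMap.ker hᵀ.mulVecLin ⊓ suppSubmodule True A : Submodule _ _) + n := by
  have h1 := finrank_ker_add_card (h.submatrix (fun i : A => (i : Fin c)) id)
  rw [Fintype.card_coe, Fintype.card_fin] at h1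
  rw [kerDim, h1]
  congr 1
  set f := Function.ExtendByZero.linearMap (ZMod 2) (fun i : A => (i : Fin c)) with hf
  have hin : ∀ (y : A → ZMod 2) (i : A), f y i = y i := fun y i =>
    Subtype.val_injective.extend_apply y 0 i
  have hout : ∀ (y : A → ZMod 2) (i : Fin c), i ∉ A → f y i = 0 := fun y i hi =>
    Function.extend_apply' (f := fun i : A => (i : Fin c)) y 0 i (by rintro ⟨a, rfl⟩; exact hi a.2)
  have hker : LinearMap.ker f = ⊥ := LinearMap.ker_eq_bot'.2 fun y hy => by
    ext i; rw [← hin y i, hy]; rfl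
  have hrange : LinearMap.range f = suppSubmodule True A := by
    ext C
    constructor
    · rintro ⟨y, rfl⟩ e he
      by_contra hn
      exact he (hout y e fun h => hn (by simp [h]))
    · intro hC
      refine ⟨fun i => C i, ?_⟩
      ext e
      by_cases he : e ∈ A
      · exact hin (fun i : A => C i) ⟨e, he⟩
      · rw [hout _ e he]
        by_contra hn
        exact he ((hC e (Ne.symm hn)).2 trivial)
  have hcomap : LinearMap.ker (h.submatrix (fun i : A => (i : Fin c)) id)ᵀ.mulVecLin =
      (LinearMap.ker hᵀ.mulVecLin).comap f := by
    ext y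
    simp only [LinearMap.mem_ker, Submodule.mem_comap, Matrix.mulVecLin_apply]
    have : (h.submatrix (fun i : A => (i : Fin c)) id)ᵀ *ᵥ y = hᵀ *ᵥ f y := by
      ext j
      simp only [Matrix.mulVec, dotProduct, Matrix.transpose_apply, Matrix.submatrix_apply, id]
      rw [← Finset.sum_subset (Finset.subset_univ A) fun i _ hi => by rw [hout y i hi, mul_zero],
        ← Finset.sum_coe_sort A]
      exact Finset.sum_congr rfl fun i _ => by rw [hin]
    rw [this]
  rw [hcomap, finrank_comap, hker, hrange, finrank_bot, add_zero, inf_comm]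

/-- A vector `x` is killed by `h_A` exactly when `h x` is supported off `A`, so the kernel is a
preimage under `h`. -/
lemma kerDim_eq (h : Matrix (Fin c) (Fin n) (ZMod 2)) (A : Finset (Fin c)) :
    kerDim h A = Module.finrank (ZMod 2)
      (LinearMap.range h.mulVecLin ⊓ suppSubmodule False A : Submodule _ _) +
        Module.finrank (ZMod 2) (LinearMap.ker h.mulVecLin) := by
  suffices hK : LinearMap.ker (h.submatrix (fun i : A => (i : Fin c)) id).mulVecLin =
      (suppSubmodule False A).comap h.mulVecLin by
    rw [← finrank_comap, kerDim, hK]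
  ext x
  simp only [LinearMap.mem_ker, Submodule.mem_comap, mem_suppSubmodule, Adm, iff_false]
  constructor
  · intro hx e he heA
    exact he (congrFun hx ⟨e, heA⟩)
  · intro hx
    ext i
    by_contra hn
    exact hx i hn i.2

lemma rcMeasure_eq_ker (h : Matrix (Fin c) (Fin n) (ZMod 2)) {p : ℝ} (A : Finset (Fin c)) :
    rcMeasure h p A = codeWeight (p / (1 - p) / 2) True (LinearMap.ker hᵀ.mulVecLin) A /
      ∑ B, codeWeight (p / (1 - p) / 2) True (LinearMap.ker hᵀ.mulVecLin) B := by
  -- By `kerDim_add_card` the weight carries a factor `2 ^ (-|A|)`, which halves the parameter `v`;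
  -- the constant `2 ^ n` cancels on normalising.
  refine rcMeasure_eq_of_rcWeight_eq (k := 2 ^ n) (by positivity) (fun A => ?_) A
  rw [codeWeight_eq, rcWeight, div_pow]
  have h1 : (2 : ℝ) ^ kerDim h A * 2 ^ A.card = 2 ^ Module.finrank (ZMod 2)
      (LinearMap.ker hᵀ.mulVecLin ⊓ suppSubmodule True A : Submodule _ _) * 2 ^ n := by
    rw [← pow_add, ← pow_add, kerDim_add_card]
  rw [eq_div_of_mul_eq (by positivity) h1]
  simp only [div_eq_mul_inv, mul_pow, inv_pow]
  ring

lemma rcMeasure_eq_range (h : Matrix (Fin c) (Fin n) (ZMod 2)) {p : ℝ} (A : Finset (Fin c)) :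
    rcMeasure h p A = codeWeight (p / (1 - p)) False (LinearMap.range h.mulVecLin) A /
      ∑ B, codeWeight (p / (1 - p)) False (LinearMap.range h.mulVecLin) B := by
  refine rcMeasure_eq_of_rcWeight_eq
    (k := 2 ^ Module.finrank (ZMod 2) (LinearMap.ker h.mulVecLin)) (by positivity) (fun A => ?_) A
  rw [codeWeight_eq, rcWeight, kerDim_eq, pow_add]
  ring

/-- This is the double orthogonal complement of `col(h)`, obtained from one inclusion and a
dimension count. It turns a dual coupling into a graph whose cycle space contains `col(h)`. -/
lemma IsPerpGenerator.ker_transpose_eq {k : ℕ} {h : Matrix (Fin c) (Fin n) (ZMod 2)}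
    {h' : Matrix (Fin c) (Fin k) (ZMod 2)} (hh : IsPerpGenerator h h') :
    LinearMap.ker h'ᵀ.mulVecLin = LinearMap.range h.mulVecLin := by
  have hdot : ∀ (x : Fin n → ZMod 2) (y : Fin c → ZMod 2), h *ᵥ x ⬝ᵥ y = (hᵀ *ᵥ y) ⬝ᵥ x := by
    intro x y
    rw [dotProduct_comm, Matrix.dotProduct_mulVec, Matrix.mulVec_transpose]
  have hrange : LinearMap.range h'.mulVecLin = LinearMap.ker hᵀ.mulVecLin := by
    ext y
    rw [hh y, LinearMap.mem_ker, Matrix.mulVecLin_apply]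
    constructor
    · intro hy
      refine dotProduct_eq_zero _ fun x => ?_
      rw [← hdot]
      exact hy _ ⟨x, rfl⟩
    · rintro hy _ ⟨x, rfl⟩
      rw [Matrix.mulVecLin_apply, hdot, hy, zero_dotProduct]
  symm
  refine Submodule.eq_of_le_of_finrank_eq ?_ ?_
  · rintro _ ⟨x, rfl⟩
    rw [LinearMap.mem_ker]
    refine dotProduct_eq_zero _ fun z => ?_
    rw [Matrix.mulVecLin_apply, Matrix.mulVec_transpose, ← Matrix.dotProduct_mulVec]
    exact (hh _).1 ⟨z, rfl⟩ _ ⟨x, rfl⟩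
  · have h1 := LinearMap.finrank_range_add_finrank_ker h.mulVecLin
    have h2 := LinearMap.finrank_range_add_finrank_ker h'.mulVecLin
    have h3 := finrank_ker_add_card h
    have h4 := finrank_ker_add_card h'
    rw [hrange] at h2
    simp only [Module.finrank_fintype_fun_eq_card, Fintype.card_fin] at h1 h2 h3 h4
    omega

end Weights

/-! ### Numerical comparison with the stated bound -/

lemma pos_of_isEdgeVertexIncidence {c m : ℕ} {g : Matrix (Fin c) (Fin m) (ZMod 2)}
    (hg : IsEdgeVertexIncidence g) (hc : 0 < c) : 0 < m :=
  (hg.exists_row ⟨0, hc⟩).choose.pos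

lemma congestion_bound_le {K : ℝ} {c n m Δ : ℕ} (hm : (m : ℝ) ≤ K * n) (hcm : 0 < c → 0 < m) :
    2 * (c : ℝ) ^ 2 * (2 ^ Δ * ((m : ℝ) ^ 2 + 1)) ≤
      1 * K ^ 4 * ((c : ℝ) ^ 2 * 2 ^ (2 * Δ + 5) * (n : ℝ) ^ 4) := by
  rcases Nat.eq_zero_or_pos c with rfl | hc
  · simp
  have hm1 : (1 : ℝ) ≤ m := by exact_mod_cast hcm hc
  -- The bound obtained is quadratic in `m` with factor `2 ^ Δ`; `m ≥ 1` (an edge has an end) lets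
  -- it be weakened to the stated fourth power.
  have h1 : (m : ℝ) ^ 2 + 1 ≤ 2 * (K * n) ^ 4 := by
    have h2 : (m : ℝ) ^ 4 ≤ (K * n) ^ 4 := by gcongr
    have h3 : (m : ℝ) ^ 2 ≤ (m : ℝ) ^ 4 := pow_le_pow_right₀ hm1 (by norm_num)
    have h4 : (1 : ℝ) ≤ (m : ℝ) ^ 4 := one_le_pow₀ hm1
    linarith
  have h5 : (2 : ℝ) ^ Δ ≤ 2 ^ (2 * Δ) := pow_le_pow_right₀ (by norm_num) (by omega)
  calc 2 * (c : ℝ) ^ 2 * (2 ^ Δ * ((m : ℝ) ^ 2 + 1))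
      ≤ 2 * (c : ℝ) ^ 2 * (2 ^ (2 * Δ) * (2 * (K * n) ^ 4)) := by gcongr
    _ ≤ 32 * (c : ℝ) ^ 2 * (2 ^ (2 * Δ) * (K * n) ^ 4) := by
        have : 0 ≤ (c : ℝ) ^ 2 * (2 ^ (2 * Δ) * (K * n) ^ 4) := by positivity
        linarith
    _ = _ := by rw [pow_add]; ring

end CodeRC

theorem mainTheorem3 :
    ∃ C : ℝ, ∀ (K : ℝ) (c n Δ : ℕ) (h : Matrix (Fin c) (Fin n) (ZMod 2)) (p : ℝ),
      0 < p → p < 1 →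
      (CodeRC.IsGraphic K Δ h ∨ CodeRC.IsCographic K Δ h) →
      ∃ F : CodeRC.StateSeq (Finset (Fin c)) → NNReal,
        CodeRC.IsFlow (CodeRC.metropolis (CodeRC.rcMeasure h p)) (CodeRC.rcMeasure h p) F ∧
        CodeRC.congestion (CodeRC.metropolis (CodeRC.rcMeasure h p)) (CodeRC.rcMeasure h p) F ≤
          ENNReal.ofReal (C * K ^ 4 * ((c : ℝ) ^ 2 * 2 ^ (2 * Δ + 5) * (n : ℝ) ^ 4)) := by
  refine ⟨1, fun K c n Δ h p hp0 hp1 hcases => ?_⟩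
  have hv : 0 < p / (1 - p) := div_pos hp0 (sub_pos.2 hp1)
  rcases hcases with ⟨m, hm, g, hg, hle, hΔ⟩ | ⟨m, hm, k, h', hh, g, hg, hle, hΔ⟩
  · obtain ⟨F, hF, hρ⟩ := CodeRC.exists_flow_of_incidence (half_pos hv) True _ hg hle hΔ
      (CodeRC.rcMeasure_eq_ker h (p := p))
    exact ⟨F, hF, hρ.trans (ENNReal.ofReal_le_ofReal (CodeRC.congestion_bound_le hm
      (CodeRC.pos_of_isEdgeVertexIncidence hg)))⟩
  · rw [hh.ker_transpose_eq] at hle hΔ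
    obtain ⟨F, hF, hρ⟩ := CodeRC.exists_flow_of_incidence hv False _ hg hle hΔ
      (CodeRC.rcMeasure_eq_range h (p := p))
    exact ⟨F, hF, hρ.trans (ENNReal.ofReal_le_ofReal (CodeRC.congestion_bound_le hm
      (CodeRC.pos_of_isEdgeVertexIncidence hg)))⟩
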